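/- A tournament is a set of vertices with an irreflexive, antisymmetric, complete binary relation $E$ (write $x\to y$ for $(x,y)\in E$); it is acyclic if it contains no $3$-cycle. A tournament $S$ embeds in $T$ if $S$ is isomorphic to a subtournament of $T$ (the tournament induced on a subset of the vertices). Given a tournament $D$ and tournaments $T_i$ ($i\in V(D)$), their lexicographical sum indexed by $D$ is the tournament on the disjoint union of the $V(T_i)$ in which $(x,i)\to(y,j)$ if either $i=j$ and $x\to y$ in $T_i$, or $i\to j$ in $D$. Let $\mathfrak A$ be the class of tournaments that are (isomorphic to) a lexicographical sum of acyclic tournaments indexed by a finite tournament. For an acyclic tournament $C=(A,<)$ define six tournaments. $C_{3[C]}$ is the lexicographical sum of copies of the $3$-cycle indexed by $C$. $V_{[C]}$ has vertex set $(A\times\{0,1\})\cup\{a\}$ with $(x,i)\to(x',i')$ if $x<x'$, or $x=x'$ and $i<i'$; $a\to(x,0)$ and $(x,1)\to a$ for all $x\in A$. The tournaments $T_{[C]},U_{[C]},H_{[C]},K_{[C]}$ have vertex set $A\times\{0,1\}$; in each of them $(x,0)\to(x,1)$ for all $x\in A$, and for all $x<y$ in $A$ one has $(x,0)\to(y,0)$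 together with: - in $T_{[C]}$: $(y,1)\to(x,0)$, $(y,0)\to(x,1)$, $(x,1)\to(y,1)$; - in $U_{[C]}$: $(x,0)\to(y,1)$, $(x,1)\to(y,0)$, $(y,1)\to(x,1)$; - in $H_{[C]}$: $(y,1)\to(x,0)$, $(x,1)\to(y,0)$, $(x,1)\to(y,1)$; - in $K_{[C]}$: $(y,1)\to(x,0)$, $(x,1)\to(y,0)$, $(y,1)\to(x,1)$. Let $\mathfrak B$ be the set of the tournaments $C_{3[C]},V_{[C]},T_{[C]},U_{[C]},H_{[C]},K_{[C]}$ for $C=\omega=(\mathbb N,<)$ and for $C=\omega^*$, the dual of $\omega$. Then: 1. Every infinite tournament either is a lexicographical sum of acyclic tournaments indexed by a finite tournament, or contains a subtournament isomorphic to a member of $\mathfrak B$. 2. $\mathfrak B$ has exactly twelve members, and no member of $\mathfrak B$ embeds in another one. 3. $\mathfrak B$ is a set of obstructions characterizing $\mathfrak A$, of minimum size. That is: no member of $\mathfrak B$ belongs to $\mathfrak A$, and an arbitrary tournament belongs to $\mathfrak A$ if and only if no member of $\mathfrak B$ embeds in it (so the two cases in 1 exclude each other); and every set $\mathcal S$ of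 tournaments with these two properties has at least as many members as $\mathfrak B$. -/

import Mathlib

universe u v

/-- A tournament: an irreflexive, antisymmetric and complete binary relation `E` (the edges) on
a type `V` (the vertices). -/
structure Tournament : Type (u + 1) where
  /-- the vertices -/
  V : Type u
  /-- the edges -/
  E : V → V → Prop
  irrefl : ∀ x, ¬ E x x
  asymm : ∀ x y, E x y → ¬ E y x
  total : ∀ x y, x ≠ y → E x y ∨ E y x

namespace Tournament

/-- `S` is embeddable into `T`: there is an isomorphism from `S` onto a subtournament of `T`. -/
def Embeds (S : Tournament.{u}) (T : Tournament.{v}) : Prop :=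
  Nonempty (S.E ↪r T.E)

/-- `S` and `T` are isomorphic. -/
def Iso (S : Tournament.{u}) (T : Tournament.{v}) : Prop :=
  Nonempty (S.E ≃r T.E)

/-- A tournament is acyclic if it contains no `3`-cycle. -/
def Acyclic (T : Tournament.{u}) : Prop :=
  ∀ x y z, ¬ (T.E x y ∧ T.E y z ∧ T.E z x)

/-- The dual tournament, with all edges reversed. -/
def dual (T : Tournament.{u}) : Tournament.{u} where
  V := T.V
  E x y := T.E y x
  irrefl := T.irrefl
  asymm x y h := T.asymm y x h
  total x y h := (T.total x y h).symm

/-- The lexicographical sum of the tournaments `F i` indexed by the tournament `D`. -/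
def lexSum (D : Tournament.{u}) (F : D.V → Tournament.{v}) : Tournament.{max u v} where
  V := Σ i, (F i).V
  E := Sigma.Lex D.E fun i => (F i).E
  irrefl := by
    rintro ⟨i, x⟩ h
    cases h with
    | left _ _ h => exact D.irrefl i h
    | right _ _ h => exact (F i).irrefl x h
  asymm := by
    rintro ⟨i, x⟩ ⟨j, y⟩ h h'
    cases h with
    | left _ _ h =>
      cases h' with
      | left _ _ h' => exact D.asymm _ _ h h'
      | right _ _ _ => exact D.irrefl _ h
    | right _ _ h =>
      cases h' with
      | left _ _ h' => exact D.irrefl _ h'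
      | right _ _ h' => exact (F _).asymm _ _ h h'
  total := by
    rintro ⟨i, x⟩ ⟨j, y⟩ h
    by_cases hij : i = j
    · subst hij
      have hxy : x ≠ y := fun e => h (by rw [e])
      rcases (F i).total x y hxy with e | e
      · exact Or.inl (Sigma.Lex.right _ _ e)
      · exact Or.inr (Sigma.Lex.right _ _ e)
    · rcases D.total i j hij with e | e
      · exact Or.inl (Sigma.Lex.left _ _ e)
      · exact Or.inr (Sigma.Lex.left _ _ e)

/-- `T` is (isomorphic to) a lexicographical sum of acyclic tournaments indexed by a finite
tournament. -/
def IsFiniteSumOfAcyclic (T : Tournament.{u}) : Prop :=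
  ∃ (D : Tournament.{u}) (F : D.V → Tournament.{u}),
    Finite D.V ∧ (∀ i, (F i).Acyclic) ∧ T.Iso (lexSum D F)

/-- The acyclic tournament made of the natural numbers and their strict order. -/
def chainOmega : Tournament.{0} where
  V := ℕ
  E x y := x < y
  irrefl := lt_irrefl
  asymm _ _ h := lt_asymm h
  total _ _ h := lt_or_gt_of_ne h

/-- The dual of `chainOmega`. -/
def chainOmegaStar : Tournament.{0} := chainOmega.dual

/-- The `3`-cycle `0 → 1 → 2 → 0`. -/
def cycle3 : Tournament.{0} where
  V := Fin 3
  E x y := y = x + 1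
  irrefl := by decide
  asymm := by decide
  total := by decide

/-- `C_{3[C]}`: the lexicographical product of the `3`-cycle by `C`, i.e. the lexicographical sum
of copies of the `3`-cycle indexed by `C`. -/
def C3 (C : Tournament.{u}) : Tournament.{u} :=
  lexSum C fun _ => cycle3

/-- The edges of `V_{[C]}`; the extra vertex `a` is `none`. -/
def VRel (C : Tournament.{u}) : Option (C.V × Fin 2) → Option (C.V × Fin 2) → Prop
  | some (x, i), some (y, j) => C.E x y ∨ (x = y ∧ i < j)
  | none, some (_, j) => j = 0
  | some (_, i), none => i = 1
  | none, none => False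

/-- `V_{[C]}`. -/
def VT (C : Tournament.{u}) : Tournament.{u} where
  V := Option (C.V × Fin 2)
  E := C.VRel
  irrefl := by
    rintro (_ | ⟨x, i⟩)
    · exact id
    · rintro (h | ⟨-, h⟩)
      · exact C.irrefl x h
      · exact lt_irrefl i h
  asymm := by
    rintro (_ | ⟨x, i⟩) (_ | ⟨y, j⟩) h h'
    · exact h
    · simp only [VRel] at h h'
      omega
    · simp only [VRel] at h h'
      omega
    · rcases h with h | ⟨rfl, h⟩ <;> rcases h' with h' | ⟨e, h'⟩
      · exact C.asymm x y h h'
      · exact C.irrefl x (e ▸ h)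
      · exact C.irrefl _ h'
      · exact lt_asymm h h'
  total := by
    rintro (_ | ⟨x, i⟩) (_ | ⟨y, j⟩) h
    · exact absurd rfl h
    · simp only [VRel]
      omega
    · simp only [VRel]
      omega
    · by_cases hxy : x = y
      · subst hxy
        have hij : i ≠ j := fun e => h (by rw [e])
        rcases lt_or_gt_of_ne hij with hl | hl
        · exact Or.inl (Or.inr ⟨rfl, hl⟩)
        · exact Or.inr (Or.inr ⟨rfl, hl⟩)
      · exact (C.total x y hxy).imp Or.inl Or.inl

/-- A pair of elements of `{0, 1} × {0, 1}`. -/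
abbrev Pair2 : Type := (Fin 2 × Fin 2) × (Fin 2 × Fin 2)

/-- `h_i = ((0, i), (1, i))`. -/
def hp (i : Fin 2) : Pair2 := ((0, i), (1, i))

/-- `v_i = ((i, 0), (i, 1))`. -/
def vp (i : Fin 2) : Pair2 := ((i, 0), (i, 1))

/-- `d_i = ((0, i), (1, i + 1))`, with `i + 1` taken modulo `2`. -/
def dp (i : Fin 2) : Pair2 := ((0, i), (1, i + 1))

/-- The edges of the directed graph `Δ(C, X)` on `C × {0, 1}`. -/
def DeltaRel (C : Tournament.{u}) (X : Finset Pair2) (p q : C.V × Fin 2) : Prop :=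
  (p.1 = q.1 ∧ ((0, p.2), (0, q.2)) ∈ X) ∨
  (C.E p.1 q.1 ∧ ((0, p.2), (1, q.2)) ∈ X) ∨
  (C.E q.1 p.1 ∧ ((1, p.2), (0, q.2)) ∈ X)

/-- The sets `X` for which `Δ(C, X)` is a tournament. -/
def Good (X : Finset Pair2) : Prop :=
  (∀ i : Fin 2, ((0, i), (0, i)) ∉ X) ∧
  (∀ i j : Fin 2, i ≠ j → (((0, i), (0, j)) ∈ X ↔ ((0, j), (0, i)) ∉ X)) ∧
  (∀ i j : Fin 2, ((0, i), (1, j)) ∈ X ↔ ((1, j), (0, i)) ∉ X)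

/-- The tournament `Δ(C, X)`. -/
def Delta (C : Tournament.{u}) (X : Finset Pair2) (hX : Good X) : Tournament.{u} where
  V := C.V × Fin 2
  E := C.DeltaRel X
  irrefl := by
    rintro ⟨x, i⟩ (h | h | h)
    · exact hX.1 i h.2
    · exact C.irrefl x h.1
    · exact C.irrefl x h.1
  asymm := by
    rintro ⟨x, i⟩ ⟨y, j⟩ h h'
    obtain ⟨h1, h2, h3⟩ := hX
    have hi := C.irrefl
    have ha := C.asymm x y
    simp only [DeltaRel] at h h'
    by_cases hxy : x = y
    · subst hxy
      have hi := C.irrefl x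
      by_cases hij : i = j
      · subst hij
        have := h1 i
        tauto
      · have := h2 i j hij
        tauto
    · have hyx : ¬ y = x := fun e => hxy e.symm
      have := h3 i j
      have := h3 j i
      tauto
  total := by
    rintro ⟨x, i⟩ ⟨y, j⟩ h
    obtain ⟨h1, h2, h3⟩ := hX
    simp only [DeltaRel]
    by_cases hxy : x = y
    · subst hxy
      have hij : i ≠ j := fun e => h (by rw [e])
      have := h2 i j hij
      tauto
    · have := C.total x y hxy
      have := h3 i j
      have := h3 j i
      tauto

/-- The set `X` defining `T_{[C]}`: `d_0⁻¹, d_1⁻¹, h_1, h_0, v_0`. -/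
def XT : Finset Pair2 := {(dp 0).swap, (dp 1).swap, hp 1, hp 0, vp 0}

/-- The set `X` defining `U_{[C]}`: `d_0, d_1, h_1⁻¹, h_0, v_0`. -/
def XU : Finset Pair2 := {dp 0, dp 1, (hp 1).swap, hp 0, vp 0}

/-- The set `X` defining `H_{[C]}`: `d_0⁻¹, d_1, h_1, h_0, v_0`. -/
def XH : Finset Pair2 := {(dp 0).swap, dp 1, hp 1, hp 0, vp 0}

/-- The set `X` defining `K_{[C]}`: `d_0⁻¹, d_1, h_1⁻¹, h_0, v_0`. -/
def XK : Finset Pair2 := {(dp 0).swap, dp 1, (hp 1).swap, hp 0, vp 0}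

/-- `T_{[C]}`. -/
def TT (C : Tournament.{u}) : Tournament.{u} := C.Delta XT (by unfold Good; decide)

/-- `U_{[C]}`. -/
def UT (C : Tournament.{u}) : Tournament.{u} := C.Delta XU (by unfold Good; decide)

/-- `H_{[C]}`. -/
def HT (C : Tournament.{u}) : Tournament.{u} := C.Delta XH (by unfold Good; decide)

/-- `K_{[C]}`. -/
def KT (C : Tournament.{u}) : Tournament.{u} := C.Delta XK (by unfold Good; decide)

/-- The set `𝔅_C` of the six tournaments built on `C`. -/
def frakBOf (C : Tournament.{u}) : Set Tournament.{u} :=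
  {C.C3, C.VT, C.TT, C.UT, C.HT, C.KT}

/-- The set `𝔅 = 𝔅_ω ∪ 𝔅_{ω*}`. -/
def frakB : Set Tournament.{0} := frakBOf chainOmega ∪ frakBOf chainOmegaStar

/-- `S` is a set of obstructions characterizing the finite lexicographical sums of acyclic
tournaments: no member of `S` is such a sum, and a tournament is such a sum if and only if no
member of `S` is embeddable into it. -/
def IsObstructionSet (S : Set Tournament.{v}) : Prop :=
  (∀ B ∈ S, ¬ B.IsFiniteSumOfAcyclic) ∧
  ∀ T : Tournament.{u}, T.IsFiniteSumOfAcyclic ↔ ∀ B ∈ S, ¬ B.Embeds T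

end Tournament

-- Membership in 𝔄 amounts to a finite colouring whose classes are acyclic and autonomous
-- (`FinModular`), and this property is hereditary. The union of two acyclic autonomous sets that
-- meet is again acyclic and autonomous, so lying in a common such set is an equivalence relation. A
-- tournament belongs to 𝔄 as soon as this relation has finitely many classes.
--
-- Suppose there are infinitely many classes and no member of 𝔅 embeds. Ramsey's theorem, applied to
-- representatives, gives a monotone sequence; cut it into consecutive pairs, named so that x → y.
-- Three further vertices suffice to certify that x and y are inequivalent (`exists_separates`). A
-- second use of Ramsey makes the edges within and between the resulting 5-tuples uniform. The
-- coordinates whose sequences interleave with that of x then form, in the first tuple, an acyclic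
-- set that no other coordinate splits (`exists_autonomous`): each way for this to fail produces one
-- of the six kinds of obstruction. This set contains x and y, so it absorbs the certificate, which
-- closes a 3-cycle inside it.
--
-- Conversely, in a member of 𝔅 no two vertices (x,0), (y,0) can share a colour. For the antichain
-- property, each member is, up to finitely many vertices, a sequence of copies of a finite set
-- related by a fixed pattern, and an embedding induces a map of patterns
-- (`IsArray.exists_row_map`). Minimality follows formally from the antichain property.

universe w

namespace Tournament

/-! ### Finite sums of acyclic tournaments as finite colourings -/

/-- A homomorphism of tournaments is an embedding. -/
theorem Embeds.of_hom {S : Tournament.{u}} {T : Tournament.{v}} (g : S.V → T.V)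
    (hg : ∀ x y, S.E x y → T.E (g x) (g y)) : S.Embeds T := by
  have inj : Function.Injective g := by
    intro x y h
    by_contra hne
    rcases S.total x y hne with e | e
    · exact T.irrefl (g x) (by simpa [h] using hg _ _ e)
    · exact T.irrefl (g x) (by simpa [h] using hg _ _ e)
  refine ⟨⟨⟨g, inj⟩, ?_⟩⟩
  intro x y
  refine ⟨fun h => ?_, hg x y⟩
  by_contra hn
  have hne : x ≠ y := fun e => T.irrefl (g x) (by simpa [e] using h)
  rcases S.total x y hne with e | e
  · exact hn e
  · exact T.asymm _ _ h (hg _ _ e)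

theorem Embeds.trans {R : Tournament.{u}} {S : Tournament.{v}} {T : Tournament.{w}}
    (h : R.Embeds S) (h' : S.Embeds T) : R.Embeds T :=
  ⟨h.some.trans h'.some⟩

/-- The vertices of `T` admit a colouring with finitely many colours all of whose classes are
acyclic and autonomous. -/
def FinModular (T : Tournament.{u}) : Prop :=
  ∃ (k : ℕ) (c : T.V → Fin k),
    (∀ x y z, c x = c y → c y = c z → ¬ (T.E x y ∧ T.E y z ∧ T.E z x)) ∧
    ∀ x y z, c x = c y → c z ≠ c x → (T.E x z ↔ T.E y z)

theorem FinModular.of_embeds {S : Tournament.{u}} {T : Tournament.{v}} (h : S.Embeds T)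
    (hT : T.FinModular) : S.FinModular := by
  obtain ⟨g⟩ := h
  obtain ⟨k, c, h1, h2⟩ := hT
  refine ⟨k, c ∘ g, fun x y z hx hy h => h1 _ _ _ hx hy ?_, fun x y z hx hz => ?_⟩
  · simpa only [g.map_rel_iff] using h
  · simpa only [g.map_rel_iff] using h2 _ _ _ hx hz

theorem isFiniteSumOfAcyclic_iff (T : Tournament.{u}) :
    T.IsFiniteSumOfAcyclic ↔ T.FinModular := by
  constructor
  · rintro ⟨D, F, hD, hF, ⟨e⟩⟩
    refine FinModular.of_embeds ⟨e.toRelEmbedding⟩ ?_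
    obtain ⟨k, ⟨s⟩⟩ := Finite.exists_equiv_fin D.V
    refine ⟨k, fun x => s x.1, ?_, ?_⟩
    · rintro ⟨i, x⟩ ⟨j, y⟩ ⟨l, z⟩ h h'
      obtain rfl : i = j := s.injective h
      obtain rfl : i = l := s.injective h'
      rintro ⟨h1, h2, h3⟩
      have key : ∀ a b : (F i).V, (lexSum D F).E ⟨i, a⟩ ⟨i, b⟩ → (F i).E a b := by
        intro a b h
        cases h with
        | left _ _ h => exact absurd h (D.irrefl i)
        | right _ _ h => exact h
      exact hF i x y z ⟨key _ _ h1, key _ _ h2, key _ _ h3⟩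
    · rintro ⟨i, x⟩ ⟨j, y⟩ ⟨l, z⟩ h h'
      obtain rfl : i = j := s.injective h
      have hl : i ≠ l := fun e => h' (by simp [e])
      have key : ∀ a : (F i).V, (lexSum D F).E ⟨i, a⟩ ⟨l, z⟩ ↔ D.E i l := by
        intro a
        refine ⟨fun h => ?_, fun h => Sigma.Lex.left _ _ h⟩
        cases h with
        | left _ _ h => exact h
        | right _ _ h => exact absurd rfl hl
      rw [key, key]
  · rintro ⟨k, c, h1, h2⟩
    -- Indexing by the quotient instead of `Fin k` keeps the index in the universe of `T` and leaves
    -- no empty class, so representatives decide the edges of `D`.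
    let π : T.V → Quotient (Setoid.ker c) := Quotient.mk _
    have hπ : ∀ {x y}, π x = π y ↔ c x = c y := fun {x y} => Quotient.eq (r := Setoid.ker c)
    have hout : ∀ q : Quotient (Setoid.ker c), π q.out = q := fun q => Quotient.out_eq q
    have hmod : ∀ x x' y y', π x = π x' → π y = π y' → π x ≠ π y → T.E x y → T.E x' y' := by
      intro x x' y y' hx hy hxy h
      rw [hπ] at hx hy
      rw [Ne, hπ] at hxy
      have h' : T.E x' y := (h2 x x' y hx (Ne.symm hxy)).1 h
      by_contra hn
      have hne : x' ≠ y' := fun e => hxy (by rw [hx, hy, e])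
      have h'' := (T.total _ _ hne).resolve_left hn
      exact T.asymm _ _ h' ((h2 y y' x' hy (by rw [← hx]; exact hxy)).2 h'')
    let D : Tournament.{u} :=
      { V := Quotient (Setoid.ker c)
        E := fun p q => p ≠ q ∧ T.E p.out q.out
        irrefl := fun _ h => h.1 rfl
        asymm := fun _ _ h h' => T.asymm _ _ h.2 h'.2
        total := fun p q h => by
          have : p.out ≠ q.out := fun e => h (by rw [← hout p, ← hout q, e])
          exact (T.total _ _ this).imp (fun e => ⟨h, e⟩) (fun e => ⟨h.symm, e⟩) }
    let F : D.V → Tournament.{u} := fun q =>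
      { V := {x // π x = q}
        E := fun x y => T.E x.1 y.1
        irrefl := fun x => T.irrefl _
        asymm := fun x y => T.asymm _ _
        total := fun x y h => T.total _ _ fun e => h (Subtype.ext e) }
    refine ⟨D, F, ?_, ?_, ?_⟩
    · exact Finite.of_injective (Quotient.lift c fun _ _ h => h) (by
        rintro ⟨x⟩ ⟨y⟩ h
        exact Quotient.sound h)
    · rintro q ⟨x, hx⟩ ⟨y, hy⟩ ⟨z, hz⟩ h
      exact h1 x y z (hπ.1 (hx.trans hy.symm)) (hπ.1 (hy.trans hz.symm)) h
    · refine ⟨⟨(Equiv.sigmaFiberEquiv π).symm, ?_⟩⟩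
      intro x y
      change Sigma.Lex D.E _ (⟨π x, ⟨x, rfl⟩⟩ : Σ q, {x // π x = q}) ⟨π y, ⟨y, rfl⟩⟩ ↔ _
      constructor
      · intro h
        rw [Sigma.lex_iff] at h
        rcases h with h | ⟨e, h⟩
        · exact hmod _ _ _ _ (hout _) (hout _) (by rw [hout, hout]; exact h.1) h.2
        · have : ∀ (q : Quotient (Setoid.ker c)) (e : π x = q) (hy : π y = q),
              (F q).E (e ▸ (⟨x, rfl⟩ : {z // π z = π x})) ⟨y, hy⟩ → T.E x y := by
            rintro q rfl hy h
            exact h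
          exact this _ e rfl h
      · intro h
        by_cases e : π x = π y
        · have : ∀ (q : Quotient (Setoid.ker c)) (hy : π y = q) (hx : π x = q),
              Sigma.Lex D.E (fun i => (F i).E) ⟨q, ⟨x, hx⟩⟩ ⟨q, ⟨y, hy⟩⟩ :=
            fun q hy hx => Sigma.Lex.right _ _ h
          have h3 := this _ rfl e
          convert h3 using 1
          exact Sigma.ext e (by
            simp only
            congr 1
            · funext z; rw [e]
            · exact proof_irrel_heq _ _)
        · exact Sigma.Lex.left _ _ ⟨e, hmod _ _ _ _ (hout _).symm (hout _).symm e h⟩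

/-! ### Ramsey's theorem and criteria for embedding the obstructions -/

/-- Infinite Ramsey theorem for pairs and finitely many colours. -/
theorem exists_strictMono_homogeneous {κ : Type*} [Finite κ] (c : ℕ → ℕ → κ) :
    ∃ φ : ℕ → ℕ, StrictMono φ ∧ ∃ k, ∀ i j, i < j → c (φ i) (φ j) = k := by
  -- A nonprincipal ultrafilter picks a limit colour for each row of `c`, then a limit of these
  -- limits; a sequence can then be chosen greedily.
  have pick : ∀ d : ℕ → κ, ∃ k, ∀ᶠ j in (Filter.hyperfilter ℕ : Filter ℕ), d j = k := by
    intro d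
    have := (Ultrafilter.eventually_exists_iff (f := Filter.hyperfilter ℕ)
      (P := fun k j => d j = k)).1 (Filter.Eventually.of_forall fun j => ⟨d j, rfl⟩)
    exact this
  choose d hd using fun i => pick (c i)
  obtain ⟨k, hk⟩ := pick d
  obtain ⟨φ, h1, h2⟩ := exists_seq_of_forall_finset_exists (fun i => d i = k)
    (fun i j => i < j ∧ c i j = k) (by
      intro s hs
      have : ∀ᶠ j in (Filter.hyperfilter ℕ : Filter ℕ), ∀ x ∈ s, x < j ∧ c x j = k := by
        rw [Filter.eventually_all_finset]
        intro x hx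
        have h3 := hd x
        rw [hs x hx] at h3
        refine Filter.Eventually.and ?_ h3
        exact Nat.hyperfilter_le_atTop (Filter.eventually_gt_atTop x)
      obtain ⟨y, hy⟩ := (hk.and this).exists
      exact ⟨y, hy⟩)
  exact ⟨φ, fun i j h => (h2 i j h).1, k, fun i j h => (h2 i j h).2⟩

theorem C3_embeds {C : Tournament.{u}} {T : Tournament.{v}} (g : Fin 3 → C.V → T.V)
    (hlt : ∀ i j x y, C.E x y → T.E (g i x) (g j y))
    (hc : ∀ i x, T.E (g i x) (g (i + 1) x)) : C.C3.Embeds T := by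
  have hc' : ∀ (i j : Fin 3) x, j = i + 1 → T.E (g i x) (g j x) := by
    rintro i _ x rfl
    exact hc i x
  refine Embeds.of_hom (fun x => g x.2 x.1) ?_
  rintro ⟨x, i⟩ ⟨y, j⟩ h
  cases h with
  | left _ _ h => exact hlt i j x y h
  | right i j h => exact hc' i j x h

theorem VT_embeds {C : Tournament.{u}} {T : Tournament.{v}} (a : T.V) (p q : C.V → T.V)
    (hlt : ∀ x y, C.E x y →
      T.E (p x) (p y) ∧ T.E (p x) (q y) ∧ T.E (q x) (p y) ∧ T.E (q x) (q y))
    (h : ∀ x, T.E (p x) (q x)) (hp : ∀ x, T.E a (p x)) (hq : ∀ x, T.E (q x) a) :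
    C.VT.Embeds T := by
  refine Embeds.of_hom (fun o => o.elim a fun x => if x.2 = 0 then p x.1 else q x.1) ?_
  rintro (_ | ⟨x, i⟩) (_ | ⟨y, j⟩) e
  · exact e.elim
  · obtain rfl : j = 0 := e
    exact hp y
  · obtain rfl : i = 1 := e
    exact hq x
  · rcases e with e | ⟨rfl, e⟩
    · obtain ⟨h1, h2, h3, h4⟩ := hlt x y e
      fin_cases i <;> fin_cases j <;> simpa
    · have h0 := h x
      revert e
      fin_cases i <;> fin_cases j <;> simp [h0]

theorem Delta_embeds {C : Tournament.{u}} {T : Tournament.{v}} {X : Finset Pair2} (hX : Good X)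
    (g : Fin 2 → C.V → T.V)
    (h : ∀ i j, ((0, i), (0, j)) ∈ X → ∀ x, T.E (g i x) (g j x))
    (h' : ∀ i j, ((0, i), (1, j)) ∈ X → ∀ x y, C.E x y → T.E (g i x) (g j y))
    (h'' : ∀ i j, ((1, i), (0, j)) ∈ X → ∀ x y, C.E y x → T.E (g i x) (g j y)) :
    (C.Delta X hX).Embeds T := by
  refine Embeds.of_hom (fun x => g x.2 x.1) ?_
  rintro ⟨x, i⟩ ⟨y, j⟩ (⟨e, hm⟩ | ⟨e, hm⟩ | ⟨e, hm⟩)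
  · dsimp only at e
    subst e
    exact h i j hm x
  · exact h' i j hm x y e
  · exact h'' i j hm x y e

theorem TT_embeds {C : Tournament.{u}} {T : Tournament.{v}} (p q : C.V → T.V)
    (hlt : ∀ x y, C.E x y →
      T.E (p x) (p y) ∧ T.E (q y) (p x) ∧ T.E (p y) (q x) ∧ T.E (q x) (q y))
    (h : ∀ x, T.E (p x) (q x)) : C.TT.Embeds T := by
  refine Delta_embeds _ ![p, q] ?_ ?_ ?_ <;> intro i j <;> fin_cases i <;> fin_cases j <;>
    simp +contextual [XT, dp, hp, vp, h, hlt]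

theorem UT_embeds {C : Tournament.{u}} {T : Tournament.{v}} (p q : C.V → T.V)
    (hlt : ∀ x y, C.E x y →
      T.E (p x) (p y) ∧ T.E (p x) (q y) ∧ T.E (q x) (p y) ∧ T.E (q y) (q x))
    (h : ∀ x, T.E (p x) (q x)) : C.UT.Embeds T := by
  refine Delta_embeds _ ![p, q] ?_ ?_ ?_ <;> intro i j <;> fin_cases i <;> fin_cases j <;>
    simp +contextual [XU, dp, hp, vp, h, hlt]

theorem HT_embeds {C : Tournament.{u}} {T : Tournament.{v}} (p q : C.V → T.V)
    (hlt : ∀ x y, C.E x y →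
      T.E (p x) (p y) ∧ T.E (q y) (p x) ∧ T.E (q x) (p y) ∧ T.E (q x) (q y))
    (h : ∀ x, T.E (p x) (q x)) : C.HT.Embeds T := by
  refine Delta_embeds _ ![p, q] ?_ ?_ ?_ <;> intro i j <;> fin_cases i <;> fin_cases j <;>
    simp +contextual [XH, dp, hp, vp, h, hlt]

theorem KT_embeds {C : Tournament.{u}} {T : Tournament.{v}} (p q : C.V → T.V)
    (hlt : ∀ x y, C.E x y →
      T.E (p x) (p y) ∧ T.E (q y) (p x) ∧ T.E (q x) (p y) ∧ T.E (q y) (q x))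
    (h : ∀ x, T.E (p x) (q x)) : C.KT.Embeds T := by
  refine Delta_embeds _ ![p, q] ?_ ?_ ?_ <;> intro i j <;> fin_cases i <;> fin_cases j <;>
    simp +contextual [XK, dp, hp, vp, h, hlt]

/-! ### Configurations of sequences excluded by the obstructions -/

/-- No member of `𝔅` embeds in `T`. -/
def AvoidsObstructions (T : Tournament.{u}) : Prop :=
  ∀ B ∈ frakB, ¬ B.Embeds T

/-- The edges between the terms of `p` and the later terms of `q` all go up (`o = true`), or all
go down (`o = false`). -/
def Dir (T : Tournament.{u}) (o : Bool) (p q : ℕ → T.V) : Prop :=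
  ∀ i j, i < j → if o then T.E (p i) (q j) else T.E (q j) (p i)

namespace AvoidsObstructions

variable {T : Tournament.{u}} {p q r : ℕ → T.V}

theorem not_C3 (hT : T.AvoidsObstructions) {o : Bool} (g : Fin 3 → ℕ → T.V)
    (hg : ∀ i j, T.Dir o (g i) (g j)) (hc : ∀ i n, T.E (g i n) (g (i + 1) n)) : False := by
  cases o
  · exact hT chainOmegaStar.C3 (by simp [frakB, frakBOf])
      (C3_embeds g (fun i j (x y : ℕ) (h : y < x) => by simpa [Dir] using hg j i y x h) hc)
  · exact hT chainOmega.C3 (by simp [frakB, frakBOf])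
      (C3_embeds g (fun i j (x y : ℕ) (h : x < y) => by simpa [Dir] using hg i j x y h) hc)

/-- A vertex splitting two interleaved sequences gives `VT`. `Dir` is silent on equal indices, so
odd indices are used for one sequence and even ones for the other. Index 0 is left out because `a`
will itself be the term of index 0 of a third sequence. -/
theorem not_split (hT : T.AvoidsObstructions) {o : Bool} (hpp : T.Dir o p p) (hpq : T.Dir o p q)
    (hqp : T.Dir o q p) (hqq : T.Dir o q q) (a : T.V) (hp : ∀ n, 0 < n → T.E a (p n))
    (hq : ∀ n, 0 < n → T.E (q n) a) : False := by
  cases o <;> simp only [Dir, if_true, if_false, Bool.false_eq_true] at hpp hpq hqp hqq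
  · refine hT chainOmegaStar.VT (by simp [frakB, frakBOf])
      (VT_embeds a (fun n : ℕ => p (2 * n + 2)) (fun n : ℕ => q (2 * n + 1)) ?_ ?_ ?_ ?_)
    · intro (x : ℕ) (y : ℕ) (h : y < x)
      exact ⟨hpp _ _ (by omega), hqp _ _ (by omega), hpq _ _ (by omega), hqq _ _ (by omega)⟩
    · exact fun x : ℕ => hqp _ _ (by omega)
    · exact fun x : ℕ => hp _ (by omega)
    · exact fun x : ℕ => hq _ (by omega)
  · refine hT chainOmega.VT (by simp [frakB, frakBOf])
      (VT_embeds a (fun n : ℕ => p (2 * n + 1)) (fun n : ℕ => q (2 * n + 2)) ?_ ?_ ?_ ?_)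
    · intro (x : ℕ) (y : ℕ) (h : x < y)
      exact ⟨hpp _ _ (by omega), hpq _ _ (by omega), hqp _ _ (by omega), hqq _ _ (by omega)⟩
    · exact fun x : ℕ => hpq _ _ (by omega)
    · exact fun x : ℕ => hp _ (by omega)
    · exact fun x : ℕ => hq _ (by omega)

/-- If `p` runs against `o`, the tournament `TT` appears when `q` does too, and `UT` when `q`
follows `o`. -/
theorem dir_self (hT : T.AvoidsObstructions) {o : Bool} (hpq : T.Dir o p q) (hqp : T.Dir o q p)
    (hp : ∃ o, T.Dir o p p) (hq : ∃ o, T.Dir o q q) : T.Dir o p p := by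
  obtain ⟨o₁, hp⟩ := hp
  obtain ⟨o₂, hq⟩ := hq
  cases o <;> cases o₁ <;> cases o₂ <;> try exact hp
  all_goals
    exfalso
    simp only [Dir, if_true, if_false, Bool.false_eq_true] at hp hpq hqp hq
  · refine hT chainOmegaStar.UT (by simp [frakB, frakBOf])
      (UT_embeds (fun n : ℕ => q (2 * n + 1)) (fun n : ℕ => p (2 * n)) ?_ ?_)
    · intro (x : ℕ) (y : ℕ) (h : y < x)
      exact ⟨hq _ _ (by omega), hpq _ _ (by omega), hqp _ _ (by omega), hp _ _ (by omega)⟩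
    · exact fun x : ℕ => hpq _ _ (by omega)
  · refine hT chainOmega.TT (by simp [frakB, frakBOf])
      (TT_embeds (fun n : ℕ => p (2 * n + 1)) (fun n : ℕ => q (2 * n)) ?_ ?_)
    · intro (x : ℕ) (y : ℕ) (h : x < y)
      exact ⟨hp _ _ (by omega), hpq _ _ (by omega), hqp _ _ (by omega), hq _ _ (by omega)⟩
    · exact fun x : ℕ => hqp _ _ (by omega)
  · refine hT chainOmegaStar.TT (by simp [frakB, frakBOf])
      (TT_embeds (fun n : ℕ => p (2 * n)) (fun n : ℕ => q (2 * n + 1)) ?_ ?_)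
    · intro (x : ℕ) (y : ℕ) (h : y < x)
      exact ⟨hp _ _ (by omega), hqp _ _ (by omega), hpq _ _ (by omega), hq _ _ (by omega)⟩
    · exact fun x : ℕ => hpq _ _ (by omega)
  · refine hT chainOmega.UT (by simp [frakB, frakBOf])
      (UT_embeds (fun n : ℕ => q (2 * n)) (fun n : ℕ => p (2 * n + 1)) ?_ ?_)
    · intro (x : ℕ) (y : ℕ) (h : x < y)
      exact ⟨hq _ _ (by omega), hqp _ _ (by omega), hpq _ _ (by omega), hp _ _ (by omega)⟩
    · exact fun x : ℕ => hqp _ _ (by omega)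

/-- The two hypotheses say that p i → q j whenever i ≠ j. A reversed diagonal then gives `HT` if `p`
and `q` run in the same direction, and `KT` otherwise. -/
theorem not_forall_diagonal (hT : T.AvoidsObstructions) (hpq : T.Dir true p q)
    (hqp : T.Dir false q p) (hp : ∃ o, T.Dir o p p) (hq : ∃ o, T.Dir o q q) :
    ¬ ∀ n, T.E (q n) (p n) := by
  intro h
  obtain ⟨o₁, hp⟩ := hp
  obtain ⟨o₂, hq⟩ := hq
  cases o₁ <;> cases o₂ <;>
    simp only [Dir, if_true, if_false, Bool.false_eq_true] at hp hpq hqp hq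
  · exact hT chainOmegaStar.HT (by simp [frakB, frakBOf]) (HT_embeds q p
      (fun (x y : ℕ) (l : y < x) => ⟨hq _ _ l, hpq _ _ l, hqp _ _ l, hp _ _ l⟩) h)
  · exact hT chainOmega.KT (by simp [frakB, frakBOf]) (KT_embeds q p
      (fun (x y : ℕ) (l : x < y) => ⟨hq _ _ l, hqp _ _ l, hpq _ _ l, hp _ _ l⟩) h)
  · exact hT chainOmegaStar.KT (by simp [frakB, frakBOf]) (KT_embeds q p
      (fun (x y : ℕ) (l : y < x) => ⟨hq _ _ l, hpq _ _ l, hqp _ _ l, hp _ _ l⟩) h)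
  · exact hT chainOmega.HT (by simp [frakB, frakBOf]) (HT_embeds q p
      (fun (x y : ℕ) (l : x < y) => ⟨hq _ _ l, hqp _ _ l, hpq _ _ l, hp _ _ l⟩) h)

end AvoidsObstructions

/-! ### Homogeneous arrays -/

/-- The edges and the equalities inside the rows of the array `f` and between two of its rows do
not depend on the choice of the rows. -/
def Homogeneous (T : Tournament.{u}) {κ : Type*} (f : ℕ → κ → T.V) : Prop :=
  ∀ a b i j, i < j → ∀ k l, k < l → (T.E (f i a) (f j b) ↔ T.E (f k a) (f l b)) ∧
    (T.E (f j b) (f i a) ↔ T.E (f l b) (f k a)) ∧ (T.E (f i a) (f i b) ↔ T.E (f k a) (f k b))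

theorem exists_homogeneous (T : Tournament.{u}) {κ : Type*} [Finite κ] (f : ℕ → κ → T.V) :
    ∃ φ : ℕ → ℕ, StrictMono φ ∧ T.Homogeneous (f ∘ φ) := by
  obtain ⟨φ, hφ, k, hk⟩ := exists_strictMono_homogeneous (κ := κ → κ → Prop × Prop × Prop)
    fun i j a b => (T.E (f i a) (f j b), T.E (f j b) (f i a), T.E (f i a) (f i b))
  refine ⟨φ, hφ, fun a b i j h i' j' h' => ?_⟩
  have := congrFun (congrFun ((hk i j h).trans (hk i' j' h').symm) a) b
  simpa only [Prod.mk.injEq, eq_iff_iff, Function.comp_apply] using this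

namespace Homogeneous

variable {T : Tournament.{u}} {κ : Type*} {f : ℕ → κ → T.V}

theorem dir_or_eq (hf : T.Homogeneous f) (a b : κ) :
    (∃ o, T.Dir o (f · a) (f · b)) ∨ ∀ i j, i < j → f i a = f j b := by
  by_cases h1 : T.E (f 0 a) (f 1 b)
  · exact Or.inl ⟨true, fun i j h => by simpa using (hf a b 0 1 one_pos i j h).1.1 h1⟩
  by_cases h2 : T.E (f 1 b) (f 0 a)
  · exact Or.inl ⟨false, fun i j h => by simpa using (hf a b 0 1 one_pos i j h).2.1.1 h2⟩
  refine Or.inr fun i j h => ?_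
  by_contra hne
  rcases T.total _ _ hne with e | e
  · exact h1 ((hf a b 0 1 one_pos i j h).1.2 e)
  · exact h2 ((hf a b 0 1 one_pos i j h).2.1.2 e)

end Homogeneous

namespace AvoidsObstructions

variable {T : Tournament.{u}} {p q r : ℕ → T.V}

/-- If the directions differed, the vertex `r 0` would split the interleaved sequences `p` and `q`.
-/
theorem dir_unique (hT : T.AvoidsObstructions) {o o₁ o₂ : Bool} (hpp : T.Dir o p p)
    (hpq : T.Dir o p q) (hqp : T.Dir o q p) (hqq : T.Dir o q q) (h₁ : T.Dir o₁ r p)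
    (h₂ : T.Dir o₂ r q) : o₁ = o₂ := by
  cases o₁ <;> cases o₂ <;> try rfl
  all_goals exfalso
  · exact hT.not_split hqq hqp hpq hpp (r 0) (fun n h => by simpa using h₂ 0 n h)
      (fun n h => by simpa using h₁ 0 n h)
  · exact hT.not_split hpp hpq hqp hqq (r 0) (fun n h => by simpa using h₁ 0 n h)
      (fun n h => by simpa using h₂ 0 n h)

end AvoidsObstructions

theorem Dir.not_eq {T : Tournament.{u}} {p : ℕ → T.V} {o : Bool} (h : T.Dir o p p) {i j : ℕ}
    (hij : i < j) : p i ≠ p j := by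
  intro e
  have := h i j hij
  rw [e] at this
  cases o <;> exact T.irrefl _ (by simpa using this)

theorem Dir.unique {T : Tournament.{u}} {p q : ℕ → T.V} {o o' : Bool} (h : T.Dir o p q)
    (h' : T.Dir o' p q) : o = o' := by
  have h := h 0 1 one_pos
  have h' := h' 0 1 one_pos
  cases o <;> cases o' <;> try rfl
  · exact (T.asymm _ _ (by simpa using h) (by simpa using h')).elim
  · exact (T.asymm _ _ (by simpa using h) (by simpa using h')).elim

namespace Homogeneous

variable {T : Tournament.{u}} {κ : Type*} {f : ℕ → κ → T.V}

/-- Otherwise the terms of index 0 and 2 of `f · a` coincide, and the term of index 1 of `f · b`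
would be joined to that vertex in both directions. -/
theorem exists_dir_self (hf : T.Homogeneous f) {a b : κ} {o : Bool}
    (hab : T.Dir o (f · a) (f · b)) (hba : T.Dir o (f · b) (f · a)) :
    ∃ o, T.Dir o (f · a) (f · a) := by
  refine (hf.dir_or_eq a a).resolve_right fun h => ?_
  have h1 := hab 0 1 one_pos
  have h2 := hba 1 2 one_lt_two
  simp only [← h 0 2 two_pos] at h2
  cases o <;> exact T.asymm _ _ (by simpa using h1) (by simpa using h2)

/-- Off the diagonal every edge goes from `f · a` to `f · b`, and excluding `HT` and `KT` forces the
diagonal to agree. A constant sequence reduces the claim to an off-diagonal edge. -/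
theorem diagonal (hf : T.Homogeneous f) (hT : T.AvoidsObstructions) {a b : κ}
    (hab : T.Dir true (f · a) (f · b)) (hba : T.Dir false (f · b) (f · a)) :
    T.E (f 0 a) (f 0 b) := by
  simp only [Dir, if_true, if_false, Bool.false_eq_true] at hab hba
  rcases hf.dir_or_eq a a with ha | ha
  swap
  · rw [ha 0 1 one_pos]
    exact hba 0 1 one_pos
  rcases hf.dir_or_eq b b with hb | hb
  swap
  · rw [hb 0 1 one_pos]
    exact hab 0 1 one_pos
  have h1 : ¬ T.E (f 0 b) (f 0 a) := fun h =>
    hT.not_forall_diagonal (by simpa [Dir] using hab) (by simpa [Dir] using hba) ha hb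
      fun n => (hf b a 0 1 one_pos n (n + 1) (Nat.lt_succ_self n)).2.2.1 h
  by_contra h2
  -- The remaining case is equality on the diagonal; homogeneity carries it to index 1, and the two
  -- off-diagonal edges between indices 0 and 1 become opposite.
  have h3 : f 0 a = f 0 b := by
    by_contra hne
    exact (T.total _ _ hne).elim h2 h1
  have h4 : f 1 a = f 1 b := by
    by_contra hne
    exact (T.total _ _ hne).elim
      (fun h => h2 ((hf a b 0 1 one_pos 1 2 one_lt_two).2.2.2 h))
      (fun h => h1 ((hf b a 0 1 one_pos 1 2 one_lt_two).2.2.2 h))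
  have h5 := hab 0 1 one_pos
  have h6 := hba 0 1 one_pos
  rw [h4, ← h3] at h6
  exact T.asymm _ _ h5 h6

/-- The rows which are interleaved with a given monotone row form an acyclic autonomous set. -/
theorem exists_autonomous (hf : T.Homogeneous f) (hT : T.AvoidsObstructions) {x y : κ} {o : Bool}
    (hxx : T.Dir o (f · x) (f · x)) (hxy : T.Dir o (f · x) (f · y))
    (hyx : T.Dir o (f · y) (f · x)) :
    ∃ M : κ → Prop, M x ∧ M y ∧
      (∀ a b c, M a → M b → M c →
        ¬ (T.E (f 0 a) (f 0 b) ∧ T.E (f 0 b) (f 0 c) ∧ T.E (f 0 c) (f 0 a))) ∧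
      ∀ s, ¬ M s → (∀ a, M a → T.E (f 0 s) (f 0 a)) ∨ (∀ a, M a → T.E (f 0 a) (f 0 s)) := by
  let M : κ → Prop := fun a => T.Dir o (f · x) (f · a) ∧ T.Dir o (f · a) (f · x)
  have hself : ∀ a, M a → T.Dir o (f · a) (f · a) := fun a ha =>
    hT.dir_self ha.2 ha.1 (hf.exists_dir_self ha.2 ha.1) ⟨o, hxx⟩
  have hMM : ∀ a b, M a → M b → T.Dir o (f · a) (f · b) := by
    intro a b ha hb
    rcases hf.dir_or_eq a b with ⟨o', h⟩ | h
    · rwa [hT.dir_unique hxx hb.1 hb.2 (hself b hb) ha.2 h]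
    · exact ((hself b hb).not_eq one_lt_two
        ((h 0 1 one_pos).symm.trans (h 0 2 two_pos))).elim
  refine ⟨M, ⟨hxx, hxx⟩, ⟨hxy, hyx⟩, ?_, ?_⟩
  · rintro a b c ha hb hc ⟨h1, h2, h3⟩
    have hM : ∀ i : Fin 3, M (![a, b, c] i) := by
      intro i
      fin_cases i <;> assumption
    refine hT.not_C3 (o := o) (fun i n => f n (![a, b, c] i))
      (fun i j => hMM _ _ (hM i) (hM j)) ?_
    intro i n
    refine (hf _ _ 0 1 one_pos n (n + 1) (Nat.lt_succ_self n)).2.2.1 ?_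
    fin_cases i <;> assumption
  · intro s hs
    have h1 : ∃ o₁, T.Dir o₁ (f · x) (f · s) :=
      (hf.dir_or_eq x s).resolve_right fun h => hxx.not_eq one_pos
        ((h 0 2 two_pos).trans (h 1 2 one_lt_two).symm)
    have h2 : ∀ a, M a → ∃ o₂, T.Dir o₂ (f · s) (f · a) := fun a ha =>
      (hf.dir_or_eq s a).resolve_right fun h => (hself a ha).not_eq one_lt_two
        ((h 0 1 one_pos).symm.trans (h 0 2 two_pos))
    obtain ⟨o₁, h1⟩ := h1
    obtain ⟨o₂, h2x⟩ := h2 x ⟨hxx, hxx⟩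
    -- Equal directions would make `s` interleave with `x`, necessarily in direction `o`, and so put
    -- `s` in `M`.
    have hne : o₁ ≠ o₂ := by
      rintro rfl
      have := hT.dir_self h1 h2x ⟨o, hxx⟩ (hf.exists_dir_self h2x h1)
      obtain rfl := this.unique hxx
      exact hs ⟨h1, h2x⟩
    have h3 : ∀ a, M a → T.Dir o₂ (f · s) (f · a) := by
      intro a ha
      obtain ⟨o₃, h⟩ := h2 a ha
      rwa [hT.dir_unique hxx ha.1 ha.2 (hself a ha) h2x h]
    -- Were `a` and `s` interleaved, the sequence of `x` would have to see both in the same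
    -- direction, against `hne`. With `h3`, this makes all off-diagonal edges between `s` and `a`
    -- point the same way, independently of `a`.
    have h4 : ∀ a, M a → T.Dir (!o₂) (f · a) (f · s) := by
      intro a ha
      rcases hf.dir_or_eq a s with ⟨o₃, h⟩ | h
      · by_cases e : o₃ = o₂
        · subst e
          have haa := hT.dir_self h (h3 a ha) ⟨o, hself a ha⟩ (hf.exists_dir_self (h3 a ha) h)
          have hss := hT.dir_self (h3 a ha) h (hf.exists_dir_self (h3 a ha) h) ⟨o, hself a ha⟩
          obtain rfl := haa.unique (hself a ha)
          exact (hne (hT.dir_unique haa h (h3 a ha) hss ha.1 h1).symm).elim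
        · rwa [← Bool.eq_not_of_ne e]
      · exact ((hself a ha).not_eq one_pos
          ((h 0 2 two_pos).trans (h 1 2 one_lt_two).symm)).elim
    cases o₂
    · exact Or.inr fun a ha => hf.diagonal hT (h4 a ha) (h3 a ha)
    · exact Or.inl fun a ha => hf.diagonal hT (h3 a ha) (h4 a ha)

end Homogeneous

/-! ### Acyclic autonomous sets and sufficiency of the obstructions -/

/-- `M` is an acyclic autonomous set of vertices. -/
def IsAcyclicAutonomous (T : Tournament.{u}) (M : Set T.V) : Prop :=
  (∀ x ∈ M, ∀ y ∈ M, ∀ z ∈ M, ¬ (T.E x y ∧ T.E y z ∧ T.E z x)) ∧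
    ∀ x ∈ M, ∀ y ∈ M, ∀ z ∉ M, T.E x z → T.E y z

theorem IsAcyclicAutonomous.union {T : Tournament.{u}} {A B : Set T.V}
    (hA : T.IsAcyclicAutonomous A) (hB : T.IsAcyclicAutonomous B) {c : T.V} (hcA : c ∈ A)
    (hcB : c ∈ B) : T.IsAcyclicAutonomous (A ∪ B) := by
  -- No 3-cycle has two vertices in an acyclic autonomous set; among three vertices of `A ∪ B`, two
  -- lie in the same set.
  have key : ∀ M : Set T.V, T.IsAcyclicAutonomous M → ∀ x y z, x ∈ M → y ∈ M →
      ¬ (T.E x y ∧ T.E y z ∧ T.E z x) := by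
    rintro M hM x y z hx hy ⟨h1, h2, h3⟩
    by_cases hz : z ∈ M
    · exact hM.1 x hx y hy z hz ⟨h1, h2, h3⟩
    · exact T.asymm _ _ h3 (hM.2 y hy x hx z hz h2)
  constructor
  · rintro x hx y hy z hz ⟨h1, h2, h3⟩
    rcases hx with hx | hx <;> rcases hy with hy | hy <;> rcases hz with hz | hz <;>
    first
    | exact key _ hA x y z hx hy ⟨h1, h2, h3⟩
    | exact key _ hA y z x hy hz ⟨h2, h3, h1⟩
    | exact key _ hA z x y hz hx ⟨h3, h1, h2⟩
    | exact key _ hB x y z hx hy ⟨h1, h2, h3⟩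
    | exact key _ hB y z x hy hz ⟨h2, h3, h1⟩
    | exact key _ hB z x y hz hx ⟨h3, h1, h2⟩
  · rintro x hx y hy z hz h
    simp only [Set.mem_union, not_or] at hz
    have hc : T.E c z := hx.elim (fun hx => hA.2 x hx c hcA z hz.1 h)
      (fun hx => hB.2 x hx c hcB z hz.2 h)
    exact hy.elim (fun hy => hA.2 c hcA y hy z hz.1 hc) (fun hy => hB.2 c hcB y hy z hz.2 hc)

/-- Two vertices are equivalent if some acyclic autonomous set contains both of them. -/
def acyclicSetoid (T : Tournament.{u}) : Setoid T.V where
  r x y := ∃ M, T.IsAcyclicAutonomous M ∧ x ∈ M ∧ y ∈ M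
  iseqv :=
    { refl := fun x => ⟨{x}, by
        refine ⟨?_, ?_⟩
        · rintro _ rfl _ rfl _ rfl h
          exact T.irrefl _ h.1
        · rintro _ rfl _ rfl z _ h
          exact h, rfl, rfl⟩
      symm := fun ⟨M, h, hx, hy⟩ => ⟨M, h, hy, hx⟩
      trans := fun ⟨M, h, hx, hy⟩ ⟨N, h', hy', hz⟩ =>
        ⟨M ∪ N, h.union h' hy hy', Or.inl hx, Or.inr hz⟩ }

theorem finModular_of_finite {T : Tournament.{u}} (h : Finite (Quotient T.acyclicSetoid)) :
    T.FinModular := by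
  obtain ⟨k, ⟨e⟩⟩ := Finite.exists_equiv_fin (Quotient T.acyclicSetoid)
  have he : ∀ {x y : T.V}, e ⟦x⟧ = e ⟦y⟧ ↔ T.acyclicSetoid.r x y := fun {x y} =>
    e.injective.eq_iff.trans Quotient.eq
  refine ⟨k, fun x => e ⟦x⟧, ?_, ?_⟩
  · intro x y z hxy hyz h
    rw [he] at hxy hyz
    obtain ⟨M, hM, hx, hy⟩ := hxy
    obtain ⟨N, hN, hy', hz⟩ := hyz
    exact (hM.union hN hy hy').1 x (Or.inl hx) y (Or.inl hy) z (Or.inr hz) h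
  · intro x y z hxy hz
    rw [he] at hxy
    rw [Ne, he] at hz
    obtain ⟨M, hM, hx, hy⟩ := hxy
    have hzM : z ∉ M := fun h => hz ⟨M, hM, h, hx⟩
    exact ⟨hM.2 x hx y hy z hzM, hM.2 y hy x hx z hzM⟩

/-- The vertices `u, v, w` witness that `x` and `y` are in no common acyclic autonomous set. -/
def Separates (T : Tournament.{u}) (x y u v w : T.V) : Prop :=
  (T.E y w ∧ T.E w x) ∨
  (T.E x v ∧ T.E v w ∧ T.E w x ∧ T.E v y ∧ T.E w y) ∨
  (T.E y v ∧ T.E v w ∧ T.E w y ∧ T.E x v ∧ T.E x w) ∨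
  (T.E u v ∧ T.E v w ∧ T.E w u ∧ (T.E x u ∧ T.E x v ∧ T.E x w) ∧ T.E u y ∧ T.E v y ∧ T.E w y)

/-- The interval formed by x, y and all z with x → z → y is acyclic and autonomous unless one of the
four configurations occurs: a vertex closing a 3-cycle with x → y, an outside vertex beating x and y
but not some interior vertex, the dual case, or a 3-cycle in the interior. -/
theorem exists_separates {T : Tournament.{u}} {x y : T.V} (hxy : T.E x y)
    (h : ¬ T.acyclicSetoid.r x y) : ∃ u v w, T.Separates x y u v w := by
  by_contra hn
  push Not at hn
  have na : ∀ w, T.E y w → ¬ T.E w x := fun w h1 h2 => hn x x w (Or.inl ⟨h1, h2⟩)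
  have nb : ∀ v w, T.E x v → T.E v w → T.E w x → T.E v y → ¬ T.E w y := fun v w h1 h2 h3 h4 h5 =>
    hn x v w (Or.inr (Or.inl ⟨h1, h2, h3, h4, h5⟩))
  have nb' : ∀ v w, T.E y v → T.E v w → T.E w y → T.E x v → ¬ T.E x w := fun v w h1 h2 h3 h4 h5 =>
    hn x v w (Or.inr (Or.inr (Or.inl ⟨h1, h2, h3, h4, h5⟩)))
  have nc : ∀ u v w, (T.E x u ∧ T.E u y) → (T.E x v ∧ T.E v y) → (T.E x w ∧ T.E w y) →
      ¬ (T.E u v ∧ T.E v w ∧ T.E w u) := fun u v w h1 h2 h3 h4 =>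
    hn u v w (Or.inr (Or.inr (Or.inr ⟨h4.1, h4.2.1, h4.2.2, ⟨h1.1, h2.1, h3.1⟩, h1.2, h2.2, h3.2⟩)))
  refine h ⟨{z | z = x ∨ z = y ∨ (T.E x z ∧ T.E z y)}, ⟨?_, ?_⟩, Or.inl rfl, Or.inr (Or.inl rfl)⟩
  · have hlow : ∀ z, z = x ∨ z = y ∨ (T.E x z ∧ T.E z y) → ¬ T.E z x := by
      rintro z (rfl | rfl | hz) h
      · exact T.irrefl _ h
      · exact T.asymm _ _ hxy h
      · exact T.asymm _ _ hz.1 h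
    have hhigh : ∀ z, z = x ∨ z = y ∨ (T.E x z ∧ T.E z y) → ¬ T.E y z := by
      rintro z (rfl | rfl | hz) h
      · exact T.asymm _ _ hxy h
      · exact T.irrefl _ h
      · exact T.asymm _ _ hz.2 h
    rintro a ha b hb c hc ⟨h1, h2, h3⟩
    have ha' : T.E x a ∧ T.E a y := by
      rcases ha with rfl | rfl | ha
      · exact (hlow c hc h3).elim
      · exact (hhigh b hb h1).elim
      · exact ha
    have hb' : T.E x b ∧ T.E b y := by
      rcases hb with rfl | rfl | hb
      · exact (hlow a ha h1).elim
      · exact (hhigh c hc h2).elim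
      · exact hb
    have hc' : T.E x c ∧ T.E c y := by
      rcases hc with rfl | rfl | hc
      · exact (hlow b hb h2).elim
      · exact (hhigh a ha h3).elim
      · exact hc
    exact nc a b c ha' hb' hc' ⟨h1, h2, h3⟩
  · have key : ∀ z, ¬ (z = x ∨ z = y ∨ (T.E x z ∧ T.E z y)) →
        (T.E z x ∧ T.E z y) ∨ (T.E x z ∧ T.E y z) := by
      intro z hz
      push Not at hz
      obtain ⟨h1, h2, h3⟩ := hz
      have h4 := T.total z x h1
      have h5 := T.total z y h2
      have := na z
      tauto
    have hiff : ∀ a, (a = x ∨ a = y ∨ (T.E x a ∧ T.E a y)) →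
        ∀ z, ¬ (z = x ∨ z = y ∨ (T.E x z ∧ T.E z y)) → (T.E a z ↔ T.E x z) := by
      rintro a ha z hz
      rcases ha with rfl | rfl | ha
      · rfl
      · rcases key z hz with h | h
        · exact iff_of_false (T.asymm _ _ h.2) (T.asymm _ _ h.1)
        · exact iff_of_true h.2 h.1
      · rcases key z hz with h | h
        · exact iff_of_false (fun h' => nb a z ha.1 h' h.1 ha.2 h.2) (T.asymm _ _ h.1)
        · refine iff_of_true ?_ h.1
          by_contra h'
          have hne : a ≠ z := by
            rintro rfl
            exact T.asymm _ _ ha.2 h.2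
          exact nb' z a h.2 ((T.total a z hne).resolve_left h') ha.2 h.1 ha.1
    intro a ha b hb z hz h
    exact (hiff b hb z hz).2 ((hiff a ha z hz).1 h)

theorem AvoidsObstructions.finModular {T : Tournament.{u}} (hT : T.AvoidsObstructions) :
    T.FinModular := by
  refine finModular_of_finite ?_
  by_contra hinf
  rw [not_finite_iff_infinite] at hinf
  let e := Infinite.natEmbedding (Quotient T.acyclicSetoid)
  obtain ⟨φ, hφ, hhom⟩ := T.exists_homogeneous (κ := Unit) fun n _ => (e n).out
  let g : ℕ → T.V := fun n => (e (φ n)).out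
  have hg : ∀ i j, i ≠ j → ¬ T.acyclicSetoid.r (g i) (g j) := by
    intro i j hij h
    have : (⟦g i⟧ : Quotient T.acyclicSetoid) = ⟦g j⟧ := Quotient.sound h
    simp only [g, Quotient.out_eq] at this
    exact hij (hφ.injective (e.injective this))
  obtain ⟨o, ho⟩ : ∃ o, T.Dir o g g := by
    refine (hhom.dir_or_eq () ()).resolve_right fun h => ?_
    have h1 : g 0 = g 1 := h 0 1 one_pos
    exact hg 0 1 zero_ne_one (h1 ▸ T.acyclicSetoid.iseqv.refl _)
  -- The pairs are the indices 2i and 2i + 1, named so that the edge goes from `s i` to `t i`.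
  -- Halving recovers the pair, so distinct pairs compare as their numbers do and the two sequences
  -- interleave.
  obtain ⟨s, t, hs, ht, hst⟩ : ∃ s t : ℕ → ℕ, (∀ i, s i / 2 = i) ∧ (∀ i, t i / 2 = i) ∧
      ∀ i, T.E (g (s i)) (g (t i)) ∧ s i ≠ t i := by
    cases o
    · refine ⟨fun i => 2 * i + 1, fun i => 2 * i, fun i => by dsimp only; omega,
        fun i => by dsimp only; omega, fun i => ⟨?_, by dsimp only; omega⟩⟩
      simpa using ho (2 * i) (2 * i + 1) (by omega)
    · refine ⟨fun i => 2 * i, fun i => 2 * i + 1, fun i => by dsimp only; omega,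
        fun i => by dsimp only; omega, fun i => ⟨?_, by dsimp only; omega⟩⟩
      simpa using ho (2 * i) (2 * i + 1) (by omega)
  choose u v w hw using fun i => exists_separates (hst i).1 (hg _ _ (hst i).2)
  obtain ⟨ψ, hψ, hf⟩ := T.exists_homogeneous
    fun n => ![g (s n), g (t n), u n, v n, w n]
  have hdir : ∀ s t : ℕ → ℕ, (∀ i, s i / 2 = i) → (∀ i, t i / 2 = i) →
      T.Dir o (fun n => g (s (ψ n))) (fun n => g (t (ψ n))) := by
    intro s t hs ht i j hij
    refine ho _ _ ?_
    have := hψ hij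
    have := hs (ψ i)
    have := ht (ψ j)
    omega
  -- Coordinates 0 to 4 stand for x, y, u, v, w. In each case below the certificate is forced into
  -- `M` vertex by vertex, since a vertex outside `M` cannot split it, until a 3-cycle lies in `M`.
  obtain ⟨M, hx, hy, hM, hmod⟩ := hf.exists_autonomous hT (x := 0) (y := 1) (o := o)
    (hdir s s hs hs) (hdir s t hs ht) (hdir t s ht hs)
  have hsep := hw (ψ 0)
  have hxy : T.E (g (s (ψ 0))) (g (t (ψ 0))) := (hst (ψ 0)).1
  rcases hsep with h | h | h | h
  · have hwM : M 4 := by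
      by_contra hn
      rcases hmod 4 hn with h' | h'
      · exact T.asymm _ _ h.1 (h' 1 hy)
      · exact T.asymm _ _ h.2 (h' 0 hx)
    exact hM 0 1 4 hx hy hwM ⟨hxy, h⟩
  · obtain ⟨h1, h2, h3, h4, h5⟩ := h
    have hvM : M 3 := by
      by_contra hn
      rcases hmod 3 hn with h' | h'
      · exact T.asymm _ _ h1 (h' 0 hx)
      · exact T.asymm _ _ h4 (h' 1 hy)
    have hwM : M 4 := by
      by_contra hn
      rcases hmod 4 hn with h' | h'
      · exact T.asymm _ _ h2 (h' 3 hvM)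
      · exact T.asymm _ _ h3 (h' 0 hx)
    exact hM 0 3 4 hx hvM hwM ⟨h1, h2, h3⟩
  · obtain ⟨h1, h2, h3, h4, h5⟩ := h
    have hwM : M 4 := by
      by_contra hn
      rcases hmod 4 hn with h' | h'
      · exact T.asymm _ _ h5 (h' 0 hx)
      · exact T.asymm _ _ h3 (h' 1 hy)
    have hvM : M 3 := by
      by_contra hn
      rcases hmod 3 hn with h' | h'
      · exact T.asymm _ _ h4 (h' 0 hx)
      · exact T.asymm _ _ h2 (h' 4 hwM)
    exact hM 1 3 4 hy hvM hwM ⟨h1, h2, h3⟩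
  · obtain ⟨h1, h2, h3, ⟨h4, h5, h6⟩, h7, h8, h9⟩ := h
    have huM : M 2 := by
      by_contra hn
      rcases hmod 2 hn with h' | h'
      · exact T.asymm _ _ h4 (h' 0 hx)
      · exact T.asymm _ _ h7 (h' 1 hy)
    have hvM : M 3 := by
      by_contra hn
      rcases hmod 3 hn with h' | h'
      · exact T.asymm _ _ h5 (h' 0 hx)
      · exact T.asymm _ _ h8 (h' 1 hy)
    have hwM : M 4 := by
      by_contra hn
      rcases hmod 4 hn with h' | h'
      · exact T.asymm _ _ h6 (h' 0 hx)
      · exact T.asymm _ _ h9 (h' 1 hy)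
    exact hM 2 3 4 huM hvM hwM ⟨h1, h2, h3⟩

theorem not_finModular_of_forall {B : Tournament.{u}} {C : Tournament.{v}} [Infinite C.V]
    (g : C.V → B.V)
    (h : ∀ (M : B.V → Prop), (∀ x y z, M x → M y → M z → ¬ (B.E x y ∧ B.E y z ∧ B.E z x)) →
      (∀ x y z, M x → M y → B.E x z → B.E z y → M z) → ∀ x y, C.E x y → M (g x) → ¬ M (g y)) :
    ¬ B.FinModular := by
  rintro ⟨k, c, h1, h2⟩
  have hne : ∀ x y, C.E x y → c (g x) ≠ c (g y) := by
    intro x y hxy e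
    refine h (fun z => c z = c (g x)) ?_ ?_ x y hxy rfl e.symm
    · exact fun a b d ha hb hd => h1 a b d (ha.trans hb.symm) (hb.trans hd.symm)
    · intro a b z ha hb haz hzb
      by_contra hz
      exact B.asymm _ _ hzb ((h2 a b z (ha.trans hb.symm) (by rwa [ha])).1 haz)
  refine not_injective_infinite_finite (c ∘ g) fun x y e => ?_
  by_contra hxy
  rcases C.total x y hxy with h | h
  · exact hne x y h e
  · exact hne y x h e.symm

section Cyclic

variable {C : Tournament.{u}} [Infinite C.V]

theorem not_finModular_C3 : ¬ C.C3.FinModular := by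
  refine not_finModular_of_forall (C := C) (fun x => ⟨x, (0 : Fin 3)⟩) ?_
  intro M hM hM' x y hxy hx hy
  have e1 : C.C3.E ⟨x, (0 : Fin 3)⟩ ⟨x, (1 : Fin 3)⟩ := Sigma.Lex.right _ _ rfl
  have e2 : C.C3.E ⟨x, (1 : Fin 3)⟩ ⟨x, (2 : Fin 3)⟩ := Sigma.Lex.right _ _ rfl
  have e3 : C.C3.E ⟨x, (2 : Fin 3)⟩ ⟨x, (0 : Fin 3)⟩ := Sigma.Lex.right _ _ rfl
  have h1 := hM' _ _ _ hx hy e1 (Sigma.Lex.left _ _ hxy)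
  exact hM _ _ _ hx h1 (hM' _ _ _ h1 hx e2 e3) ⟨e1, e2, e3⟩

theorem not_finModular_VT : ¬ C.VT.FinModular := by
  refine not_finModular_of_forall (C := C) (fun x => some (x, 0)) ?_
  intro M hM hM' x y hxy hx hy
  have e1 : C.VT.E (some (x, 0)) (some (x, 1)) := Or.inr ⟨rfl, by decide⟩
  have e2 : C.VT.E (some (x, 1)) none := rfl
  have e3 : C.VT.E none (some (x, 0)) := rfl
  have h1 := hM' _ _ _ hx hy e1 (Or.inl hxy)
  exact hM _ _ _ hx h1 (hM' _ _ _ h1 hx e2 e3) ⟨e1, e2, e3⟩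

/-- The four sets `X` defining `T_{[C]}`, `U_{[C]}`, `H_{[C]}` and `K_{[C]}`. -/
def edgeSet : Fin 4 → Finset Pair2 := ![XT, XU, XH, XK]

instance : DecidablePred Good := fun X => by
  unfold Good
  infer_instance

theorem good_edgeSet : ∀ i, Good (edgeSet i) := by
  decide

theorem vp_zero_mem_edgeSet : ∀ i, ((0, 0), (0, 1)) ∈ edgeSet i := by
  decide

theorem hp_zero_mem_edgeSet : ∀ i, ((0, 0), (1, 0)) ∈ edgeSet i := by
  decide

theorem swap_dp_zero_mem_edgeSet : ∀ i, i ≠ 1 → ((1, 1), (0, 0)) ∈ edgeSet i := by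
  decide

theorem dp_one_mem_edgeSet_one : ((0, 1), (1, 0)) ∈ edgeSet 1 := by
  decide

theorem swap_hp_one_mem_edgeSet_one : ((1, 1), (0, 1)) ∈ edgeSet 1 := by
  decide

theorem Embeds.edge_of_eq {S : Tournament.{u}} {T : Tournament.{v}} (g : S.E ↪r T.E) {x y : S.V}
    {x' y' : T.V} (hx : g x = x') (hy : g y = y') : T.E x' y' ↔ S.E x y := by
  subst hx hy
  exact g.map_rel_iff

theorem not_finModular_Delta (i : Fin 4) : ¬ (C.Delta (edgeSet i) (good_edgeSet i)).FinModular := by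
  refine not_finModular_of_forall (C := C) (fun x => (x, (0 : Fin 2))) ?_
  intro M hM hM' x y hxy hx hy
  have e1 : ∀ z, (C.Delta (edgeSet i) (good_edgeSet i)).E (z, (0 : Fin 2)) (z, (1 : Fin 2)) :=
    fun z => Or.inl ⟨rfl, vp_zero_mem_edgeSet i⟩
  have e2 : (C.Delta (edgeSet i) (good_edgeSet i)).E (x, (0 : Fin 2)) (y, (0 : Fin 2)) :=
    Or.inr (Or.inl ⟨hxy, hp_zero_mem_edgeSet i⟩)
  -- Index 1 is `UT`, the only one of the four without the edge (y,1) → (x,0). There convexity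
  -- captures (x,1), then (y,1), and the cycle is (y,0), (y,1), (x,1); elsewhere it is (x,0), (y,0),
  -- (y,1).
  by_cases hi : i = 1
  · subst hi
    have e3 : (C.Delta (edgeSet 1) (good_edgeSet 1)).E (x, (1 : Fin 2)) (y, (0 : Fin 2)) :=
      Or.inr (Or.inl ⟨hxy, dp_one_mem_edgeSet_one⟩)
    have e4 : (C.Delta (edgeSet 1) (good_edgeSet 1)).E (y, (1 : Fin 2)) (x, (1 : Fin 2)) :=
      Or.inr (Or.inr ⟨hxy, swap_hp_one_mem_edgeSet_one⟩)
    have h1 := hM' _ _ _ hx hy (e1 x) e3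
    exact hM _ _ _ hy (hM' _ _ _ hy h1 (e1 y) e4) h1 ⟨e1 y, e4, e3⟩
  · have e3 : (C.Delta (edgeSet i) (good_edgeSet i)).E (y, (1 : Fin 2)) (x, (0 : Fin 2)) :=
      Or.inr (Or.inr ⟨hxy, swap_dp_zero_mem_edgeSet i hi⟩)
    exact hM _ _ _ hx hy (hM' _ _ _ hy hx (e1 y) e3) ⟨e2, e1 y, e3⟩

end Cyclic

/-! ### The obstructions form an antichain -/

/-- The array `β` contains all but finitely many vertices, and its rows are related according to
the pattern `F`. -/
structure IsArray (B : Tournament.{u}) {κ : Type*} (β : ℕ → κ → B.V) (F : κ → κ → Prop) :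
    Prop where
  edge_iff : ∀ {i j n m}, n < m → (B.E (β n i) (β m j) ↔ F i j)
  finite_compl : (Set.range fun x : ℕ × κ => β x.1 x.2)ᶜ.Finite
  injective : ∀ i, Function.Injective fun n => β n i

namespace IsArray

variable {B : Tournament.{u}} {B' : Tournament.{v}} {κ κ' : Type*} {β : ℕ → κ → B.V}
  {β' : ℕ → κ' → B'.V} {F : κ → κ → Prop} {F' : κ' → κ' → Prop}

/-- An embedding sends all but finitely many terms of each `β · i` beyond any given index of the
target array, and a nonprincipal ultrafilter selects which sequence receives them. The second
conclusion also exposes edges within a single index, which the patterns do not record. -/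
theorem exists_row_map [Finite κ] [Finite κ'] (h : B.IsArray β F) (h' : B'.IsArray β' F')
    (g : B.E ↪r B'.E) :
    ∃ r : κ → κ', (∀ i j, F i j ↔ F' (r i) (r j)) ∧
      ∀ N, ∃ n > N, ∃ c : κ → ℕ, ∀ i, N < c i ∧ g (β n i) = β' (c i) (r i) := by
  have fin : ∀ N, {v | ¬ ∃ j, ∃ m > N, v = β' m j}.Finite := by
    intro N
    refine (h'.finite_compl.union
      (((Set.finite_Iic N).prod Set.finite_univ).image fun x : ℕ × κ' => β' x.1 x.2)).subset ?_
    intro v hv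
    by_cases hr : v ∈ Set.range fun x : ℕ × κ' => β' x.1 x.2
    · obtain ⟨⟨m, j⟩, rfl⟩ := hr
      refine Or.inr ⟨(m, j), ⟨?_, trivial⟩, rfl⟩
      by_contra hm
      exact hv ⟨j, m, not_le.1 hm, rfl⟩
    · exact Or.inl hr
  have ev : ∀ N, ∃ r : κ → κ', ∀ᶠ n in (Filter.hyperfilter ℕ : Filter ℕ),
      ∀ i, ∃ m > N, g (β n i) = β' m (r i) := by
    intro N
    refine Ultrafilter.eventually_exists_iff.1 ?_
    have : ∀ i, ∀ᶠ n in (Filter.hyperfilter ℕ : Filter ℕ), ∃ j, ∃ m > N, g (β n i) = β' m j := by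
      intro i
      refine Filter.hyperfilter_le_cofinite ?_
      have hinj : Function.Injective fun n => g (β n i) := g.injective.comp (h.injective i)
      exact (fin N).preimage hinj.injOn
    filter_upwards [Filter.eventually_all.2 this] with n hn
    choose r hr using hn
    exact ⟨r, hr⟩
  have hQ : ∃ r : κ → κ', ∀ᶠ N in (Filter.hyperfilter ℕ : Filter ℕ),
      ∀ᶠ n in (Filter.hyperfilter ℕ : Filter ℕ), ∀ i, ∃ m > N, g (β n i) = β' m (r i) :=
    Ultrafilter.eventually_exists_iff.1 (Filter.Eventually.of_forall ev)
  obtain ⟨r, hr⟩ := hQ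
  have key : ∀ N, ∃ n > N, ∃ c : κ → ℕ, ∀ i, N < c i ∧ g (β n i) = β' (c i) (r i) := by
    intro N
    obtain ⟨N', hN', hlt⟩ := (hr.and (Nat.hyperfilter_le_atTop (Filter.eventually_ge_atTop N))).exists
    obtain ⟨n, hn, hn'⟩ := (hN'.and (Nat.hyperfilter_le_atTop (Filter.eventually_gt_atTop N))).exists
    choose c hc using hn
    exact ⟨n, hn', c, fun i => ⟨lt_of_le_of_lt hlt (hc i).1, (hc i).2⟩⟩
  refine ⟨r, fun i j => ?_, key⟩
  obtain ⟨n, -, c, hc⟩ := key 0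
  -- The second index is taken large enough to be later both in the source and in the target, so
  -- that both patterns can be read off the same edge.
  obtain ⟨n', hn', c', hc'⟩ := key (max n (c i))
  rw [← h.edge_iff (lt_of_le_of_lt (le_max_left _ _) hn'), ← g.map_rel_iff, (hc i).2, (hc' j).2,
    h'.edge_iff (lt_of_le_of_lt (le_max_right _ _) (hc' j).1)]

theorem lt_iff_of_edge (h : B.IsArray β F) {k : κ} {n m : ℕ} (e : B.E (β n k) (β m k)) :
    (n < m ∧ F k k) ∨ (m < n ∧ ¬ F k k) := by
  rcases lt_trichotomy n m with l | rfl | l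
  · exact Or.inl ⟨l, (h.edge_iff l).1 e⟩
  · exact (B.irrefl _ e).elim
  · exact Or.inr ⟨l, fun hF => B.asymm _ _ e ((h.edge_iff l).2 hF)⟩

theorem not_cycle (h : B.IsArray β F) (k : κ) (n m l : ℕ) :
    ¬ (B.E (β n k) (β m k) ∧ B.E (β m k) (β l k) ∧ B.E (β l k) (β n k)) := by
  rintro ⟨h1, h2, h3⟩
  have h1 := h.lt_iff_of_edge h1
  have h2 := h.lt_iff_of_edge h2
  have h3 := h.lt_iff_of_edge h3
  by_cases hF : F k k <;> simp only [hF, and_true, and_false, not_true, not_false_eq_true,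
    or_false, false_or] at h1 h2 h3 <;> omega

end IsArray

/-- `ω` if `o = true`, and its dual if `o = false`. -/
def orientedChain (o : Bool) : Tournament.{0} where
  V := ℕ
  E x y := match o with
    | true => x < y
    | false => y < x
  irrefl := by cases o <;> exact fun x => lt_irrefl x
  asymm := by cases o <;> exact fun x y h => lt_asymm h
  total := by cases o <;> intro x y h <;> simp only <;> omega

instance (o : Bool) : Infinite (orientedChain o).V := inferInstanceAs (Infinite ℕ)

theorem orientedChain_edge_iff {o : Bool} {n m : ℕ} (h : n < m) :
    (orientedChain o).E n m ↔ o = true := by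
  cases o
  · exact iff_of_false (lt_asymm h) (by decide)
  · exact iff_of_true h rfl

theorem orientedChain_edge_iff' {o : Bool} {n m : ℕ} (h : n < m) :
    (orientedChain o).E m n ↔ o = false := by
  cases o
  · exact iff_of_true h rfl
  · exact iff_of_false (lt_asymm h) (by decide)

theorem isArray_C3 (o : Bool) : (orientedChain o).C3.IsArray
    (fun n (i : Fin 3) => ⟨n, i⟩) (fun _ _ => o = true) where
  edge_iff {i j n m} h := by
    rw [← orientedChain_edge_iff h]
    refine ⟨fun e => ?_, fun e => Sigma.Lex.left _ _ e⟩
    cases e with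
    | left _ _ e => exact e
    | right _ _ e => exact absurd h (lt_irrefl _)
  finite_compl := Set.finite_empty.subset fun v h => h ⟨(v.1, v.2), rfl⟩
  injective i n m h := congrArg Sigma.fst h

theorem isArray_VT (o : Bool) : (orientedChain o).VT.IsArray
    (fun n (i : Fin 2) => some (n, i)) (fun _ _ => o = true) where
  edge_iff {i j n m} h := by
    rw [← orientedChain_edge_iff h]
    exact ⟨fun e => e.resolve_right fun e => h.ne e.1, Or.inl⟩
  finite_compl := by
    refine (Set.finite_singleton none).subset ?_
    rintro (_ | ⟨n, i⟩) h
    · rfl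
    · exact (h ⟨(n, i), rfl⟩).elim
  injective i n m h := congrArg Prod.fst (Option.some.inj h)

/-- The relation between an earlier and a later column in `Δ(C, X)`, for `C = ω` or `C = ω*`. -/
def columnPattern (o : Bool) (X : Finset Pair2) (i j : Fin 2) : Prop :=
  (if o then ((0, i), (1, j)) else ((1, i), (0, j)) : Pair2) ∈ X

instance (o : Bool) (X : Finset Pair2) (i j : Fin 2) : Decidable (columnPattern o X i j) :=
  inferInstanceAs (Decidable (_ ∈ X))

theorem isArray_Delta (o : Bool) (X : Finset Pair2) (hX : Good X) :
    ((orientedChain o).Delta X hX).IsArray (fun n (i : Fin 2) => (n, i)) (columnPattern o X) where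
  edge_iff {i j n m} h := by
    change (n = m ∧ _ ∨ (orientedChain o).E n m ∧ _ ∨ (orientedChain o).E m n ∧ _) ↔ _
    rw [orientedChain_edge_iff h, orientedChain_edge_iff' h]
    cases o <;> simp [columnPattern, h.ne]
  finite_compl := Set.finite_empty.subset fun v h => h ⟨(v.1, v.2), rfl⟩
  injective i n m h := congrArg Prod.fst h

/-- Without its vertex a, this tournament is a lexicographic linear order. -/
theorem VT_not_cycle {o : Bool} (x y z : ℕ × Fin 2) :
    ¬ ((orientedChain o).VT.E (some x) (some y) ∧ (orientedChain o).VT.E (some y) (some z) ∧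
      (orientedChain o).VT.E (some z) (some x)) := by
  obtain ⟨x, i⟩ := x
  obtain ⟨y, j⟩ := y
  obtain ⟨z, k⟩ := z
  rintro ⟨h1, h2, h3⟩
  cases o
  · change (y < x ∨ x = y ∧ i < j) at h1
    change (z < y ∨ y = z ∧ j < k) at h2
    change (x < z ∨ z = x ∧ k < i) at h3
    omega
  · change (x < y ∨ x = y ∧ i < j) at h1
    change (y < z ∨ y = z ∧ j < k) at h2
    change (z < x ∨ z = x ∧ k < i) at h3
    omega

/-- The image of a is a term of the array (`hsurj`), so its edges to all later terms of one sequence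
agree. It must split the images of the two sequences of V, whereas `hF` says that sequences related
by a constant pattern cannot be told apart by an earlier term. -/
theorem not_VT_embeds {B : Tournament.{u}} {κ : Type*} [Finite κ] {β : ℕ → κ → B.V}
    {F : κ → κ → Prop} (hB : B.IsArray β F) (hsurj : ∀ v, ∃ n i, v = β n i) {o : Bool}
    (hF : ∀ i j, (∀ a ∈ [i, j], ∀ b ∈ [i, j], F a b ↔ o = true) → ∀ k, F k i ↔ F k j) :
    ¬ (orientedChain o).VT.Embeds B := by
  rintro ⟨g⟩
  obtain ⟨r, hr, h⟩ := (isArray_VT o).exists_row_map hB g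
  obtain ⟨m, k, hk⟩ := hsurj (g none)
  obtain ⟨n, -, c, hc⟩ := h m
  have h0 : F k (r 0) := by
    rw [← hB.edge_iff (hc 0).1, Embeds.edge_of_eq g hk (hc 0).2]
    rfl
  have h1 : ¬ F k (r 1) := by
    rw [← hB.edge_iff (hc 1).1, Embeds.edge_of_eq g hk (hc 1).2]
    exact (one_ne_zero : (1 : Fin 2) ≠ 0)
  refine h1 ((hF (r 0) (r 1) ?_ k).1 h0)
  simp [← hr]

/-- The members of `𝔅`. -/
def obstruction : Option (Option (Fin 4)) × Bool → Tournament.{0}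
  | (none, o) => (orientedChain o).C3
  | (some none, o) => (orientedChain o).VT
  | (some (some i), o) => (orientedChain o).Delta (edgeSet i) (good_edgeSet i)

theorem frakB_eq_range : frakB = Set.range obstruction := by
  ext B
  constructor
  · rintro ((rfl | rfl | rfl | rfl | rfl | rfl) | (rfl | rfl | rfl | rfl | rfl | rfl))
    · exact ⟨(none, true), rfl⟩
    · exact ⟨(some none, true), rfl⟩
    · exact ⟨(some (some 0), true), rfl⟩
    · exact ⟨(some (some 1), true), rfl⟩
    · exact ⟨(some (some 2), true), rfl⟩
    · exact ⟨(some (some 3), true), rfl⟩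
    · exact ⟨(none, false), rfl⟩
    · exact ⟨(some none, false), rfl⟩
    · exact ⟨(some (some 0), false), rfl⟩
    · exact ⟨(some (some 1), false), rfl⟩
    · exact ⟨(some (some 2), false), rfl⟩
    · exact ⟨(some (some 3), false), rfl⟩
  · rintro ⟨⟨_ | _ | i, _ | _⟩, rfl⟩
    · exact Or.inr (Or.inl rfl)
    · exact Or.inl (Or.inl rfl)
    · exact Or.inr (Or.inr (Or.inl rfl))
    · exact Or.inl (Or.inr (Or.inl rfl))
    · refine Or.inr (Or.inr (Or.inr ?_))
      fin_cases i
      exacts [Or.inl rfl, Or.inr (Or.inl rfl), Or.inr (Or.inr (Or.inl rfl)),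
        Or.inr (Or.inr (Or.inr rfl))]
    · refine Or.inl (Or.inr (Or.inr ?_))
      fin_cases i
      exacts [Or.inl rfl, Or.inr (Or.inl rfl), Or.inr (Or.inr (Or.inl rfl)),
        Or.inr (Or.inr (Or.inr rfl))]

theorem columnPattern_row_eq : ∀ (o o' : Bool) (x : Fin 4) (i j : Fin 2),
    (∀ a ∈ [i, j], ∀ b ∈ [i, j], columnPattern o' (edgeSet x) a b ↔ o = true) → i = j := by
  decide

theorem columnPattern_not_constant : ∀ (o o' : Bool) (x : Fin 4),
    ¬ ∀ i j, columnPattern o (edgeSet x) i j ↔ o' = true := by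
  decide

theorem columnPattern_injective : ∀ (o o' : Bool) (x x' : Fin 4) (a b : Fin 2),
    (∀ i j, columnPattern o (edgeSet x) i j ↔
      columnPattern o' (edgeSet x') (if i = 0 then a else b) (if j = 0 then a else b)) →
    x = x' ∧ o = o' := by
  decide

theorem eq_of_obstruction_embeds {p q : Option (Option (Fin 4)) × Bool}
    (h : (obstruction p).Embeds (obstruction q)) : p = q := by
  obtain ⟨_ | _ | i, o⟩ := p <;> obtain ⟨_ | _ | j, o'⟩ := q
  · obtain ⟨g⟩ := h
    obtain ⟨r, hr, -⟩ := (isArray_C3 o).exists_row_map (isArray_C3 o') g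
    rw [Bool.eq_iff_iff.2 (hr 0 0)]
  · exfalso
    obtain ⟨g⟩ := h
    obtain ⟨r, -, h⟩ := (isArray_C3 o).exists_row_map (isArray_VT o') g
    obtain ⟨n, -, c, hc⟩ := h 0
    refine VT_not_cycle (o := o') (c 0, r 0) (c 1, r 1) (c 2, r 2) ?_
    refine ⟨(Embeds.edge_of_eq g (hc 0).2 (hc 1).2).2 ?_,
      (Embeds.edge_of_eq g (hc 1).2 (hc 2).2).2 ?_,
      (Embeds.edge_of_eq g (hc 2).2 (hc 0).2).2 ?_⟩ <;> exact Sigma.Lex.right _ _ rfl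
  · exfalso
    obtain ⟨g⟩ := h
    obtain ⟨r, hr, h⟩ := (isArray_C3 o).exists_row_map (isArray_Delta o' _ (good_edgeSet j)) g
    -- The pattern of `C3` is constant, so all three sequences land in one sequence of the target,
    -- which is a chain and has room for no 3-cycle.
    have hr' : ∀ i, r i = r 0 := fun i =>
      columnPattern_row_eq o o' j _ _ (by simp [← hr])
    obtain ⟨n, -, c, hc⟩ := h 0
    refine (isArray_Delta o' _ (good_edgeSet j)).not_cycle (r 0) (c 0) (c 1) (c 2) ?_
    have h0 := (hc 0).2
    have h1 := (hc 1).2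
    have h2 := (hc 2).2
    rw [hr' 1] at h1
    rw [hr' 2] at h2
    refine ⟨(Embeds.edge_of_eq g h0 h1).2 ?_, (Embeds.edge_of_eq g h1 h2).2 ?_,
      (Embeds.edge_of_eq g h2 h0).2 ?_⟩ <;> exact Sigma.Lex.right _ _ rfl
  · exact (not_VT_embeds (isArray_C3 o') (fun v => ⟨v.1, v.2, rfl⟩)
      (fun _ _ _ _ => Iff.rfl) h).elim
  · obtain ⟨g⟩ := h
    obtain ⟨r, hr, -⟩ := (isArray_VT o).exists_row_map (isArray_VT o') g
    rw [Bool.eq_iff_iff.2 (hr 0 0)]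
  · refine (not_VT_embeds (isArray_Delta o' _ (good_edgeSet j)) (fun v => ⟨v.1, v.2, rfl⟩)
      (fun a b hab k => ?_) h).elim
    rw [columnPattern_row_eq o o' j a b hab]
  · obtain ⟨g⟩ := h
    obtain ⟨r, hr, -⟩ := (isArray_Delta o _ (good_edgeSet i)).exists_row_map (isArray_C3 o') g
    exact (columnPattern_not_constant o o' i hr).elim
  · obtain ⟨g⟩ := h
    obtain ⟨r, hr, -⟩ := (isArray_Delta o _ (good_edgeSet i)).exists_row_map (isArray_VT o') g
    exact (columnPattern_not_constant o o' i hr).elim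
  · obtain ⟨g⟩ := h
    obtain ⟨r, hr, -⟩ := (isArray_Delta o _ (good_edgeSet i)).exists_row_map
      (isArray_Delta o' _ (good_edgeSet j)) g
    have hr' : ∀ i, r i = if i = 0 then r 0 else r 1 := by
      intro i
      fin_cases i <;> rfl
    obtain ⟨rfl, rfl⟩ := columnPattern_injective o o' i j (r 0) (r 1) fun a b => by
      rw [← hr', ← hr', hr]
    rfl

theorem not_finModular_of_mem {B : Tournament.{0}} (hB : B ∈ frakB) : ¬ B.FinModular := by
  rw [frakB_eq_range] at hB
  obtain ⟨⟨_ | _ | i, o⟩, rfl⟩ := hB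
  · exact not_finModular_C3
  · exact not_finModular_VT
  · exact not_finModular_Delta i

theorem eq_of_embeds {B B' : Tournament.{0}} (hB : B ∈ frakB) (hB' : B' ∈ frakB)
    (h : B.Embeds B') : B = B' := by
  rw [frakB_eq_range] at hB hB'
  obtain ⟨p, rfl⟩ := hB
  obtain ⟨q, rfl⟩ := hB'
  rw [eq_of_obstruction_embeds h]

theorem encard_frakB : frakB.encard = 12 := by
  have hinj : Function.Injective obstruction := fun p q h =>
    eq_of_obstruction_embeds (h ▸ ⟨RelEmbedding.refl _⟩)
  rw [frakB_eq_range, ← Set.image_univ, hinj.encard_image, Set.encard_univ, ENat.card_eq_coe_natCard]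
  simp

theorem isObstructionSet_frakB : IsObstructionSet.{u, 0} frakB := by
  refine ⟨fun B hB => ?_, fun T => ⟨fun hT B hB h => ?_, fun hT => ?_⟩⟩
  · rw [isFiniteSumOfAcyclic_iff]
    exact not_finModular_of_mem hB
  · rw [isFiniteSumOfAcyclic_iff] at hT
    exact not_finModular_of_mem hB (hT.of_embeds h)
  · rw [isFiniteSumOfAcyclic_iff]
    exact AvoidsObstructions.finModular hT

theorem exists_embeds_of_not {T : Tournament.{u}} (hT : ¬ T.IsFiniteSumOfAcyclic) :
    ∃ B ∈ frakB, B.Embeds T := by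
  by_contra h
  push Not at h
  exact hT ((isObstructionSet_frakB.2 T).2 h)

/-! ### Minimality -/

/-- A copy of `T` in another universe. -/
def lift (T : Tournament.{u}) : Tournament.{max u v} where
  V := ULift.{v} T.V
  E x y := T.E x.down y.down
  irrefl _ := T.irrefl _
  asymm _ _ := T.asymm _ _
  total _ _ h := T.total _ _ fun e => h (ULift.down_injective e)

theorem embeds_lift (T : Tournament.{u}) : T.Embeds (lift.{u, v} T) :=
  .of_hom ULift.up fun _ _ h => h

theorem lift_embeds (T : Tournament.{u}) : (lift.{u, v} T).Embeds T :=
  .of_hom ULift.down fun _ _ h => h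

/-- Each B in 𝔅 lies outside 𝔄, so some `A ∈ S` embeds in it. As A is outside 𝔄 too, a member of 𝔅
embeds in A, hence in B, and must be B by the antichain property. Thus A determines B. The lift is
needed because `S` only tests tournaments in universe `u`. -/
theorem encard_frakB_le {S : Set Tournament.{v}} (hS : IsObstructionSet.{u, v} S) :
    frakB.encard ≤ S.encard := by
  have : ∀ B : frakB, ∃ A ∈ S, A.Embeds (lift.{0, u} B.1) := by
    rintro ⟨B, hB⟩
    by_contra h
    push Not at h
    have := (hS.2 _).2 h
    exact (isObstructionSet_frakB.2 _).1 this B hB (embeds_lift B)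
  choose s hsS hs using this
  have hinj : Function.Injective fun B : frakB => (⟨s B, hsS B⟩ : S) := by
    intro B B' h
    have h : s B = s B' := congrArg Subtype.val h
    obtain ⟨A, hA, hA'⟩ := exists_embeds_of_not (hS.1 _ (hsS B))
    have h1 := eq_of_embeds hA B.2 ((hA'.trans (hs B)).trans (lift_embeds _))
    rw [h] at hA'
    have h2 := eq_of_embeds hA B'.2 ((hA'.trans (hs B')).trans (lift_embeds _))
    exact Subtype.ext (h1.symm.trans h2)
  exact ENat.card_le_card_of_injective hinj

end Tournament

theorem corollary1 :
    -- every infinite tournament is a finite sum of acyclic ones or contains a member of `𝔅`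
    (∀ T : Tournament.{u}, Infinite T.V →
      (T.IsFiniteSumOfAcyclic ∨ ∃ B ∈ Tournament.frakB, B.Embeds T)) ∧
    -- the members of `𝔅`, twelve in number, do not embed in each other
    Tournament.frakB.encard = 12 ∧
    (∀ B ∈ Tournament.frakB, ∀ B' ∈ Tournament.frakB, B ≠ B' → ¬ B.Embeds B') ∧
    -- `𝔅` is a set of obstructions of minimum size
    Tournament.IsObstructionSet.{u, 0} Tournament.frakB ∧
    (∀ S : Set Tournament.{v}, Tournament.IsObstructionSet.{u, v} S →
      Tournament.frakB.encard ≤ S.encard) := by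
  refine ⟨fun T _ => or_iff_not_imp_left.2 Tournament.exists_embeds_of_not,
    Tournament.encard_frakB, fun B hB B' hB' hne h => hne (Tournament.eq_of_embeds hB hB' h),
    Tournament.isObstructionSet_frakB, fun S hS => Tournament.encard_frakB_le hS⟩
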